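/- A hypergraph here is $\mathscr G=(V,E,I,\psi,\phi)$ with finite disjoint sets $V$ (vertices), $E$ (edges), $I$ (hinges), a map $\psi:I\to V$ and a surjection $\phi:I\to E$; the degree of $v\in V$ is $|\psi^{-1}(v)|$, and an edge $e$ joins exactly the vertices of a set $U\subseteq V$ if $|\{x\in I:\psi(x)=v,\ \phi(x)=e\}|$ is $1$ for $v\in U$ and $0$ for $v\in V\setminus U$. Parallel edges are allowed. Let $n\ge 1$, let $\Lambda=[\lambda_1\dots\lambda_m]^T$ be a vector of positive integers and let $H=[h_1\dots h_m]^T$ be a vector of pairwise distinct integers with $1\le h_j\le n$ for $1\le j\le m$. Let $\Lambda K_n^H$ be a hypergraph with $n$ vertices such that, for $1\le j\le m$, for every set $U$ of $h_j$ vertices exactly $\lambda_j$ edges join exactly the vertices of $U$, and such that there are no other edges. Let $Q=[q_1\dots q_k]^T$ and $R=[r_1\dots r_k]^T$ be integer vectors. A $(Q,R)$-factorization of $\Lambda K_n^H$ is a partition of its edge set into $k$ (possibly empty) classes $F_1,\dots,F_k$ such that, for $1\le i\le k$, in the spanning sub-hypergraph with edge set $F_i$ (all $n$ vertices, the edges in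 $F_i$, and all hinges of these edges) every vertex $v$ has degree $d(v)$ with $q_i\le d(v)\le r_i$. **Theorem.** $\Lambda K_n^H$ has a $(Q,R)$-factorization if and only if $$\sum_{i=1}^k q_i\ \le\ \sum_{j=1}^m\lambda_j\binom{n-1}{h_j-1}\ \le\ \sum_{i=1}^k r_i$$ and there is a $k\times m$ matrix $A=[a_{ij}]$ of nonnegative integers such that $n q_i\le\sum_{j=1}^m a_{ij}h_j\le n r_i$ for $1\le i\le k$ and $\sum_{i=1}^k a_{ij}=\lambda_j\binom{n}{h_j}$ for $1\le j\le m$. -/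

import Mathlib

open scoped Matrix

universe u v w

/-- A hypergraph with vertex set `V`, edge set `E` and hinge set `I`: every hinge is attached to one
vertex (`vert`, the map `ψ`) and to one edge (`edge`, the surjection `φ`). Parallel edges, and edges
containing a vertex with multiplicity, are allowed. -/
structure HingeHypergraph (V : Type u) (E : Type v) (I : Type w) where
  vert : I → V
  edge : I → E
  edge_surjective : Function.Surjective edge

namespace HingeHypergraph

variable {V : Type u} {E : Type v} {I : Type w}

/-- `H(v, e)`: the hinges attaching the edge `e` to the vertex `v`. -/
def hingesAt (G : HingeHypergraph V E I) (v : V) (e : E) : Set I :=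
  {x | G.vert x = v ∧ G.edge x = e}

/-- `d(v)`: the number of hinges incident with `v`. -/
noncomputable def degree (G : HingeHypergraph V E I) (v : V) : ℕ :=
  {x | G.vert x = v}.ncard

/-- `E(U)`: the edges whose multiset of vertices (counted with hinges) is exactly `U`. -/
def edgesJoining [DecidableEq V] (G : HingeHypergraph V E I) (U : Multiset V) : Set E :=
  {e | ∀ v, (G.hingesAt v e).ncard = U.count v}

/-- `m(U) = |E(U)|`: the multiplicity of `U`. -/
noncomputable def multiplicity [DecidableEq V] (G : HingeHypergraph V E I) (U : Multiset V) : ℕ :=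
  (G.edgesJoining U).ncard

/-- The spanning sub-hypergraph with edge set `F`: all vertices of `G`, the edges in `F`, and all
hinges of these edges. -/
def spanningSub (G : HingeHypergraph V E I) (F : Set E) :
    HingeHypergraph V {e // e ∈ F} {x // G.edge x ∈ F} where
  vert x := G.vert x.1
  edge x := ⟨G.edge x.1, x.2⟩
  edge_surjective := by
    rintro ⟨e, he⟩
    obtain ⟨x, rfl⟩ := G.edge_surjective e
    exact ⟨⟨x, he⟩, rfl⟩

/-- The edge set `F` forms a `(q, r)`-factor of `G`. -/
def IsFactor (G : HingeHypergraph V E I) (q r : ℤ) (F : Set E) : Prop :=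
  ∀ v, q ≤ ((G.spanningSub F).degree v : ℤ) ∧ ((G.spanningSub F).degree v : ℤ) ≤ r

/-- `F 0, …, F (k - 1)` is a `(Q, R)`-factorization: the classes are pairwise disjoint, cover all
edges, and the `i`-th one is a `(Q i, R i)`-factor. Classes may be empty. -/
structure IsFactorization (G : HingeHypergraph V E I) {k : ℕ} (Q R : Fin k → ℤ)
    (F : Fin k → Set E) : Prop where
  disjoint : Pairwise fun i j => Disjoint (F i) (F j)
  cover : ⋃ i, F i = Set.univ
  factor : ∀ i, G.IsFactor (Q i) (R i) (F i)

/-- `G` is `(Q, R)`-factorizable. -/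
def Factorizable (G : HingeHypergraph V E I) {k : ℕ} (Q R : Fin k → ℤ) : Prop :=
  ∃ F : Fin k → Set E, G.IsFactorization Q R F

/-- `G` is a `Λ K_n^H` on its vertex set, `Λ = lam` and `H = h`: every set of `h j` vertices is joined
by exactly `lam j` edges, and every edge joins some set of `h j` vertices, for some `j`. -/
structure IsLambdaK [DecidableEq V] (G : HingeHypergraph V E I) {m : ℕ} (lam h : Fin m → ℕ) :
    Prop where
  multiplicity_eq : ∀ (j : Fin m) (U : Finset V), U.card = h j → G.multiplicity U.1 = lam j
  edge_joins : ∀ e : E, ∃ (j : Fin m) (U : Finset V), U.card = h j ∧ e ∈ G.edgesJoining U.1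

/-- The standard model of `Λ K_n^H`: `lam j` labelled copies of each set of `h j` vertices. -/
def lambdaK (V : Type u) {m : ℕ} (lam h : Fin m → ℕ) (hpos : ∀ j, 1 ≤ h j) :
    HingeHypergraph V (Σ j : Fin m, {U : Finset V // U.card = h j} × Fin (lam j))
      (Σ e : (Σ j : Fin m, {U : Finset V // U.card = h j} × Fin (lam j)),
        {v : V // v ∈ e.2.1.1}) where
  vert x := x.2.1
  edge x := x.1
  edge_surjective := by
    intro e
    have hc : 0 < e.2.1.1.card := by
      rw [e.2.1.2]
      exact hpos _
    obtain ⟨v, hv⟩ := Finset.card_pos.1 hc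
    exact ⟨⟨e, v, hv⟩, rfl⟩

lemma mem_edgesJoining_lambdaK [DecidableEq V] {m : ℕ} (lam h : Fin m → ℕ) (hpos : ∀ j, 1 ≤ h j)
    (e : Σ j : Fin m, {U : Finset V // U.card = h j} × Fin (lam j)) (U : Finset V) :
    e ∈ (lambdaK V lam h hpos).edgesJoining U.1 ↔ e.2.1.1 = U := by
  have key : ∀ v, ((lambdaK V lam h hpos).hingesAt v e).ncard = e.2.1.1.1.count v := by
    intro v
    rw [Multiset.count_eq_of_nodup e.2.1.1.2]
    split_ifs with hv
    · rw [Set.ncard_eq_one]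
      refine ⟨⟨e, v, hv⟩, ?_⟩
      ext ⟨e', v', hv'⟩
      constructor
      · rintro ⟨h1, h2⟩
        change v' = v at h1
        change e' = e at h2
        subst h1 h2
        rfl
      · intro hx
        rw [Set.mem_singleton_iff] at hx
        rw [hx]
        exact ⟨rfl, rfl⟩
    · suffices hs : (lambdaK V lam h hpos).hingesAt v e = ∅ by
        rw [hs, Set.ncard_empty]
      refine Set.eq_empty_iff_forall_notMem.2 ?_
      rintro ⟨e', v', hv'⟩ ⟨h1, h2⟩
      change v' = v at h1
      change e' = e at h2
      subst h1 h2
      exact hv hv'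
  constructor
  · intro he
    apply Finset.val_injective
    refine Multiset.ext.2 fun v => ?_
    rw [← key]
    exact he v
  · rintro rfl v
    exact key v

/-- The standard model is a `Λ K_n^H` when the sizes `h j` are distinct. -/
theorem isLambdaK_lambdaK [DecidableEq V] {m : ℕ} (lam h : Fin m → ℕ) (hpos : ∀ j, 1 ≤ h j)
    (hinj : Function.Injective h) : (lambdaK V lam h hpos).IsLambdaK lam h := by
  constructor
  · intro j U hU
    have hset : (lambdaK V lam h hpos).edgesJoining U.1 =
        Set.range fun c : Fin (lam j) => (⟨j, ⟨U, hU⟩, c⟩ :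
          Σ j : Fin m, {U : Finset V // U.card = h j} × Fin (lam j)) := by
      ext e
      rw [mem_edgesJoining_lambdaK]
      constructor
      · obtain ⟨j', ⟨U', hU'⟩, c⟩ := e
        rintro rfl
        obtain rfl : j = j' := hinj (hU.symm.trans hU')
        exact ⟨c, rfl⟩
      · rintro ⟨c, rfl⟩
        rfl
    rw [multiplicity, hset, Set.ncard_range_of_injective]
    · simp
    · intro a b hab
      simpa using hab
  · rintro ⟨j, ⟨U, hU⟩, c⟩
    exact ⟨j, U, hU, (mem_edgesJoining_lambdaK lam h hpos _ _).2 rfl⟩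

end HingeHypergraph

/-! Necessity is double counting. If a_ij edges of size h_j lie in class i, the degrees in that
class sum to ∑_j a_ij h_j; summing over i and using h·C(n,h) = n·C(n-1,h-1) gives the inequalities
for ∑ q_i and ∑ r_i.

Sufficiency follows Baranyai. Vertices are processed one at a time, and only the number of edges of
each class and size with each trace S on the processed set is recorded (`exists_trace_counts`);
initially these numbers are the entries of A. With N+1 vertices left, letting the next vertex v join
the fraction (h_j - |S|)/(N+1) of the edges with trace S is an average over the remaining vertices,
so it meets every linear requirement: the right total for each trace, degree of v in [q_i, r_i], and
a suitable number of hinges left for the other N vertices. These requirements bound entries, row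
sums and column sums of a matrix whose rows are the classes and whose columns are the pairs (j, S),
so an integral solution exists too (`exists_int_rounding`, from integrality of transportation
polytopes). After the last vertex the traces are the full vertex sets, and parallel edges are
distributed among the classes by number (`factorizable_of_counts`). -/

/-! ### Integral rounding of matrices -/

section Rounding

variable {ι κ : Type*} [Fintype ι] [Fintype κ]

/-- A nonempty set of cells of a matrix that meets no row and no column in exactly one cell
supports a nonzero matrix whose row and column sums vanish. -/
theorem exists_balanced_of_no_isolated [DecidableEq ι] [DecidableEq κ] (F : Finset (ι × κ))
    (hF : F.Nonempty) (hr : ∀ p ∈ F, ∃ q ∈ F, q ≠ p ∧ q.1 = p.1)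
    (hc : ∀ p ∈ F, ∃ q ∈ F, q ≠ p ∧ q.2 = p.2) :
    ∃ z : ι × κ → ℝ, z ≠ 0 ∧ (∀ p ∉ F, z p = 0) ∧ (∀ i, ∑ k, z (i, k) = 0) ∧
      ∀ k, ∑ i, z (i, k) = 0 := by
  classical
  let R := F.image Prod.fst
  let C := F.image Prod.snd
  have hR : 2 * R.card ≤ F.card := by
    refine Finset.mul_card_image_le_card _ _ ?_
    intro i hi
    obtain ⟨p, hp, rfl⟩ := Finset.mem_image.1 hi
    obtain ⟨q, hq, hne, h1⟩ := hr p hp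
    exact Finset.one_lt_card.2 ⟨q, by simp [hq, h1], p, by simp [hp], hne⟩
  have hC : 2 * C.card ≤ F.card := by
    refine Finset.mul_card_image_le_card _ _ ?_
    intro i hi
    obtain ⟨p, hp, rfl⟩ := Finset.mem_image.1 hi
    obtain ⟨q, hq, hne, h1⟩ := hc p hp
    exact Finset.one_lt_card.2 ⟨q, by simp [hq, h1], p, by simp [hp], hne⟩
  let M : Matrix (R ⊕ C) F ℝ := fun a p =>
    Sum.elim (fun r : R => if p.1.1 = r.1 then 1 else 0) (fun c : C => if p.1.2 = c.1 then 1 else 0) a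
  -- Counting only gives |R| + |C| ≤ |F|, which may be an equality. Every cell lies in one row and
  -- one column, so `w` is a left null vector of the incidence matrix; if `M` were injective it
  -- would be onto, `w` would be in its range, and w·w would be 0.
  let w : R ⊕ C → ℝ := Sum.elim (fun _ => 1) (fun _ => -1)
  have hw : w ᵥ* M = 0 := by
    ext p
    have h1 : ∑ r : R, (if p.1.1 = r.1 then (1 : ℝ) else 0) = 1 := by
      rw [Finset.sum_eq_single ⟨p.1.1, Finset.mem_image_of_mem _ p.2⟩]
      · simp
      · intro b _ hb
        exact if_neg fun h => hb (Subtype.ext h.symm)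
      · simp
    have h2 : ∑ r : C, (if p.1.2 = r.1 then (1 : ℝ) else 0) = 1 := by
      rw [Finset.sum_eq_single ⟨p.1.2, Finset.mem_image_of_mem _ p.2⟩]
      · simp
      · intro b _ hb
        exact if_neg fun h => hb (Subtype.ext h.symm)
      · simp
    simp only [Matrix.vecMul, dotProduct, Fintype.sum_sum_type, w, M, Sum.elim_inl, Sum.elim_inr,
      Pi.zero_apply, one_mul, neg_mul, Finset.sum_neg_distrib]
    rw [h1, h2, add_neg_cancel]
  have hinj : ¬ Function.Injective M.mulVecLin := by
    intro hi
    have hle := LinearMap.finrank_le_finrank_of_injective hi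
    simp only [Module.finrank_fintype_fun_eq_card, Fintype.card_sum, Fintype.card_coe] at hle
    have heq : Module.finrank ℝ (F → ℝ) = Module.finrank ℝ (R ⊕ C → ℝ) := by
      simp only [Module.finrank_fintype_fun_eq_card, Fintype.card_sum, Fintype.card_coe]
      omega
    have hs := (LinearMap.injective_iff_surjective_of_finrank_eq_finrank heq).1 hi
    obtain ⟨z, hz⟩ := hs w
    have h0 : w ⬝ᵥ w = 0 := by
      nth_rewrite 2 [← hz]
      rw [Matrix.mulVecLin_apply, Matrix.dotProduct_mulVec, hw, zero_dotProduct]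
    rw [dotProduct_self_eq_zero] at h0
    obtain ⟨p, hp⟩ := hF
    have := congrFun h0 (Sum.inl ⟨p.1, Finset.mem_image_of_mem _ hp⟩)
    simp [w] at this
  obtain ⟨z, hz, hz0⟩ : ∃ z, M.mulVecLin z = 0 ∧ z ≠ 0 := by
    by_contra! hcon
    exact hinj ((injective_iff_map_eq_zero _).2 hcon)
  let z' : ι × κ → ℝ := fun p => if h : p ∈ F then z ⟨p, h⟩ else 0
  have hz' : ∀ p ∉ F, z' p = 0 := fun p hp => dif_neg hp
  have hsum : ∀ g : ι × κ → ℝ, ∑ p, g p * z' p = ∑ p : F, g p.1 * z p := by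
    intro g
    rw [← Finset.sum_subset (Finset.subset_univ F) fun p _ hp => by rw [hz' p hp, mul_zero],
      ← Finset.sum_coe_sort]
    exact Finset.sum_congr rfl fun p _ => by simp [z']
  refine ⟨z', ?_, hz', ?_, ?_⟩
  · intro h
    refine hz0 (funext fun p => ?_)
    simpa [z'] using congrFun h p.1
  · intro i
    by_cases hi : i ∈ R
    · have h1 := hsum fun p => if p.1 = i then 1 else 0
      have h2 : ∑ p : F, (if p.1.1 = i then 1 else 0) * z p = 0 :=
        congrFun hz (Sum.inl ⟨i, hi⟩)
      rw [h2, Fintype.sum_prod_type] at h1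
      rw [← h1, Finset.sum_eq_single i]
      · simp
      · intro b _ hb
        simp [hb]
      · simp
    · exact Finset.sum_eq_zero fun k _ => hz' _ fun h => hi (Finset.mem_image_of_mem Prod.fst h)
  · intro k
    by_cases hk : k ∈ C
    · have h1 := hsum fun p => if p.2 = k then 1 else 0
      have h2 : ∑ p : F, (if p.1.2 = k then 1 else 0) * z p = 0 :=
        congrFun hz (Sum.inr ⟨k, hk⟩)
      rw [h2, Fintype.sum_prod_type_right] at h1
      rw [← h1, Finset.sum_eq_single k]
      · simp
      · intro b _ hb
        simp [hb]
      · simp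
    · exact Finset.sum_eq_zero fun i _ => hz' _ fun h => hk (Finset.mem_image_of_mem Prod.snd h)

/-- If the sum of a family of reals is an integer, no single member is the only non-integer. -/
theorem exists_ne_not_int {α : Type*} [Fintype α] (f : α → ℝ) (s : ℤ) (hs : ∑ a, f a = s) (a : α)
    (ha : f a ∉ Set.range ((↑) : ℤ → ℝ)) : ∃ b, b ≠ a ∧ f b ∉ Set.range ((↑) : ℤ → ℝ) := by
  classical
  by_contra! hcon
  refine ha ?_
  have h1 : f a = s - ∑ b ∈ Finset.univ.erase a, f b := by
    rw [← hs, ← Finset.add_sum_erase _ _ (Finset.mem_univ a)]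
    ring
  have h2 : ∀ b ∈ Finset.univ.erase a, f b = ((⌊f b⌋ : ℤ) : ℝ) := by
    intro b hb
    obtain ⟨t, ht⟩ := hcon b (Finset.ne_of_mem_erase hb)
    rw [← ht, Int.floor_intCast]
  rw [Finset.sum_congr rfl h2] at h1
  exact ⟨s - ∑ b ∈ Finset.univ.erase a, ⌊f b⌋, by rw [h1]; push_cast; rfl⟩

/-- Integrality of transportation polytopes. -/
theorem exists_int_transport (l u : ι × κ → ℤ) (r : ι → ℤ) (c : κ → ℤ) (x : ι × κ → ℝ)
    (hl : ∀ p, l p ≤ x p) (hu : ∀ p, x p ≤ u p) (hr : ∀ i, ∑ k, x (i, k) = r i)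
    (hc : ∀ k, ∑ i, x (i, k) = c k) :
    ∃ y : ι × κ → ℤ, (∀ p, l p ≤ y p) ∧ (∀ p, y p ≤ u p) ∧ (∀ i, ∑ k, y (i, k) = r i) ∧
      ∀ k, ∑ i, y (i, k) = c k := by
  classical
  let P : Set (ι × κ → ℝ) := Set.Icc (fun p => (l p : ℝ)) (fun p => (u p : ℝ)) ∩
    {y | (∀ i, ∑ k, y (i, k) = r i) ∧ ∀ k, ∑ i, y (i, k) = c k}
  have hP : IsCompact P := by
    refine isCompact_Icc.inter_right ?_
    simp only [Set.ofPred_and, Set.ofPred_forall]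
    refine (isClosed_iInter fun i => ?_).inter (isClosed_iInter fun k => ?_)
    · exact isClosed_eq (by fun_prop) continuous_const
    · exact isClosed_eq (by fun_prop) continuous_const
  obtain ⟨y, hy⟩ := hP.extremePoints_nonempty ⟨x, ⟨hl, hu⟩, hr, hc⟩
  obtain ⟨⟨⟨hyl, hyu⟩, hyr, hyc⟩, hext⟩ := hy
  have hint : ∀ p, y p ∈ Set.range ((↑) : ℤ → ℝ) := by
    by_contra! hcon
    obtain ⟨p₀, hp₀⟩ := hcon
    let F : Finset (ι × κ) := {p | y p ∉ Set.range ((↑) : ℤ → ℝ)}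
    have memF : ∀ p, p ∈ F ↔ y p ∉ Set.range ((↑) : ℤ → ℝ) := fun p => by
      simp only [F, Finset.mem_filter, Finset.mem_univ, true_and]
    -- Integral row and column sums leave no non-integral entry alone in its line. Non-integral
    -- entries lie strictly between the integral bounds, so `y` can move both ways along `z`,
    -- contradicting extremality.
    obtain ⟨z, hz0, hzF, hzr, hzc⟩ := exists_balanced_of_no_isolated F ⟨p₀, (memF _).2 hp₀⟩
      (by
        intro p hp
        obtain ⟨b, hb, hbi⟩ := exists_ne_not_int (fun k => y (p.1, k)) _ (hyr p.1) p.2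
          ((memF _).1 hp)
        exact ⟨(p.1, b), (memF _).2 hbi, fun h => hb (congrArg Prod.snd h), rfl⟩)
      (by
        intro p hp
        obtain ⟨b, hb, hbi⟩ := exists_ne_not_int (fun i => y (i, p.2)) _ (hyc p.2) p.1
          ((memF _).1 hp)
        exact ⟨(b, p.2), (memF _).2 hbi, fun h => hb (congrArg Prod.fst h), rfl⟩)
    have hcont : ∀ p, Filter.Tendsto (fun ε : ℝ => y p + ε * z p) (nhds 0) (nhds (y p)) := by
      intro p
      have : Continuous fun ε : ℝ => y p + ε * z p := by fun_prop
      simpa using this.tendsto 0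
    have hev : ∀ᶠ ε : ℝ in nhds 0, ∀ p, (l p : ℝ) ≤ y p + ε * z p ∧ y p + ε * z p ≤ u p := by
      refine Filter.eventually_all.2 fun p => ?_
      by_cases hp : p ∈ F
      · have hp' := (memF p).1 hp
        have h1 : (l p : ℝ) < y p := lt_of_le_of_ne (hyl p) fun h => hp' ⟨_, h⟩
        have h2 : y p < u p := lt_of_le_of_ne (hyu p) fun h => hp' ⟨_, h.symm⟩
        filter_upwards [(hcont p).eventually (lt_mem_nhds h1), (hcont p).eventually
          (gt_mem_nhds h2)] with ε ha hb
        exact ⟨ha.le, hb.le⟩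
      · refine Filter.Eventually.of_forall fun ε => ?_
        rw [hzF p hp, mul_zero, add_zero]
        exact ⟨hyl p, hyu p⟩
    obtain ⟨δ, hδ, hball⟩ := Metric.eventually_nhds_iff.1 hev
    have hmem : ∀ ε : ℝ, |ε| < δ → (fun p => y p + ε * z p) ∈ P := by
      intro ε hε
      have := hball (y := ε) (by simpa [Real.dist_eq] using hε)
      refine ⟨⟨fun p => (this p).1, fun p => (this p).2⟩, fun i => ?_, fun k => ?_⟩
      · rw [Finset.sum_add_distrib, ← Finset.mul_sum, hzr, mul_zero, add_zero, hyr]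
      · rw [Finset.sum_add_distrib, ← Finset.mul_sum, hzc, mul_zero, add_zero, hyc]
    have hδ2 : |δ / 2| < δ := by rw [abs_of_pos (by linarith)]; linarith
    have h1 := hmem (δ / 2) hδ2
    have h2 := hmem (-(δ / 2)) (by rwa [abs_neg])
    have h3 := hext h1 h2 ⟨1 / 2, 1 / 2, by norm_num, by norm_num, by norm_num, by
      ext p
      simp only [Pi.add_apply, Pi.smul_apply, smul_eq_mul]
      ring⟩
    refine hz0 (funext fun p => ?_)
    have h4 : y p + δ / 2 * z p = y p := congrFun h3 p
    have h5 : δ / 2 * z p = 0 := by linarith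
    exact (mul_eq_zero.1 h5).resolve_left (by linarith)
  choose Y hY using hint
  refine ⟨Y, fun p => ?_, fun p => ?_, fun i => ?_, fun k => ?_⟩
  · exact Int.cast_le.1 ((hyl p).trans_eq (hY p).symm)
  · exact Int.cast_le.1 ((hY p).trans_le (hyu p))
  · have := hyr i
    simp only [← hY] at this
    exact_mod_cast this
  · have := hyc k
    simp only [← hY] at this
    exact_mod_cast this

/-- A nonnegative matrix with integral column sums, whose entries and row sums have given integral
bounds, can be replaced by an integral matrix with the same column sums and bounds. -/
theorem exists_int_rounding (u : ι → κ → ℤ) (a b : ι → ℤ) (c : κ → ℤ) (x : ι → κ → ℝ)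
    (hx : ∀ i k, 0 ≤ x i k) (hu : ∀ i k, x i k ≤ u i k) (ha : ∀ i, a i ≤ ∑ k, x i k)
    (hb : ∀ i, ∑ k, x i k ≤ b i) (hc : ∀ k, ∑ i, x i k = c k) :
    ∃ y : ι → κ → ℤ, (∀ i k, 0 ≤ y i k) ∧ (∀ i k, y i k ≤ u i k) ∧
      (∀ i, a i ≤ ∑ k, y i k) ∧ (∀ i, ∑ k, y i k ≤ b i) ∧ ∀ k, ∑ i, y i k = c k := by
  -- The extra column `none` holds the slack of each row below `b i`. The row sums become exactly `b
  -- i`, and the lower bound `a i` becomes the capacity `b i - a i` of the slack.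
  obtain ⟨y, hy0, hyu, hyr, hyc⟩ := exists_int_transport (ι := ι) (κ := Option κ) 0
    (fun p => p.2.elim (b p.1 - a p.1) (u p.1)) b
    (fun k => k.elim (∑ i, b i - ∑ k, c k) c)
    (fun p => p.2.elim (b p.1 - ∑ k, x p.1 k) (x p.1))
    (by
      rintro ⟨i, _ | k⟩
      · simpa using hb i
      · simpa using hx i k)
    (by
      rintro ⟨i, _ | k⟩
      · have := ha i
        simp only [Option.elim_none, Int.cast_sub]
        linarith
      · simpa using hu i k)
    (by
      intro i
      simp [Fintype.sum_option])
    (by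
      rintro (_ | k)
      · simp only [Option.elim_none, Finset.sum_sub_distrib]
        rw [Finset.sum_comm]
        simp [hc]
      · simpa using hc k)
  refine ⟨fun i k => y (i, some k), fun i k => hy0 _, fun i k => hyu (i, some k), fun i => ?_,
    fun i => ?_, fun k => hyc (some k)⟩
  · have h1 := hyr i
    have h2 := hyu (i, none)
    rw [Fintype.sum_option] at h1
    simp only [Option.elim_none] at h2
    linarith
  · have h1 := hyr i
    have h2 := hy0 (i, none)
    rw [Fintype.sum_option] at h1
    simp only [Pi.zero_apply] at h2
    linarith

end Rounding

/-! ### Vertex-by-vertex construction of the edge counts -/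

section Counts

/-- The number of `h`-sets that extend a given `s`-set by elements of a given `N`-set. -/
def extensionCount (N h s : ℕ) : ℤ := if s ≤ h then (N.choose (h - s) : ℤ) else 0

/-- Pascal's rule: an extension avoids or contains a given new element. At s = h the guard `s ≤ h`
matters, since truncated subtraction would make the last term 1. -/
theorem extensionCount_succ (N h s : ℕ) :
    extensionCount (N + 1) h s = extensionCount N h s + extensionCount N h (s + 1) := by
  unfold extensionCount
  rcases lt_trichotomy s h with hs | rfl | hs
  · obtain ⟨t, rfl⟩ := Nat.exists_eq_add_of_lt hs
    have h1 : s + t + 1 - s = t + 1 := by omega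
    have h2 : s + t + 1 - (s + 1) = t := by omega
    rw [if_pos (by omega), if_pos (by omega), if_pos (by omega), h1, h2, Nat.choose_succ_succ]
    push_cast
    ring
  · simp
  · rw [if_neg (by omega), if_neg (by omega), if_neg (by omega), add_zero]

/-- Double counting of pairs of an extension and one of its h - s added elements. It makes the
column sums of the fractional choice integral. -/
theorem extensionCount_succ_mul (N h s : ℕ) :
    extensionCount (N + 1) h s * ((h : ℤ) - s) = (N + 1) * extensionCount N h (s + 1) := by
  unfold extensionCount
  rcases lt_trichotomy s h with hs | rfl | hs
  · obtain ⟨t, rfl⟩ := Nat.exists_eq_add_of_lt hs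
    have h1 : s + t + 1 - s = t + 1 := by omega
    have h2 : s + t + 1 - (s + 1) = t := by omega
    rw [if_pos (by omega), if_pos (by omega), h1, h2]
    have := Nat.add_one_mul_choose_eq N t
    have h3 : ((N + 1 : ℕ) : ℤ) * (N.choose t : ℕ) = ((N + 1).choose (t + 1) : ℕ) * (t + 1 : ℕ) := by
      exact_mod_cast this
    push_cast at h3 ⊢
    rw [h3]
    ring
  · simp
  · rw [if_neg (by omega), if_neg (by omega)]
    simp

/-- This keeps the fraction (h - s)/N in [0, 1] for every trace that carries edges. -/
theorem extensionCount_ne_zero {N h s : ℕ} (hc : extensionCount N h s ≠ 0) :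
    s ≤ h ∧ h ≤ s + N := by
  unfold extensionCount at hc
  split_ifs at hc with hs
  · refine ⟨hs, ?_⟩
    by_contra hlt
    exact hc (by rw [Nat.choose_eq_zero_of_lt (by omega), Nat.cast_zero])
  · exact absurd rfl hc

/-- Baranyai's vertex-by-vertex construction: `f i j S` is the number of edges of size `h j` in the
`i`-th class whose trace on the set `T` of vertices processed so far is `S`. -/
theorem exists_trace_counts {V : Type*} [Fintype V] [DecidableEq V] {k m : ℕ} (lam h : Fin m → ℕ)
    (Q R : Fin k → ℤ) (A : Fin k → Fin m → ℕ)
    (hQ : ∀ i, (Fintype.card V : ℤ) * Q i ≤ ∑ j, (A i j : ℤ) * h j)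
    (hR : ∀ i, ∑ j, (A i j : ℤ) * h j ≤ (Fintype.card V : ℤ) * R i)
    (hA : ∀ j, ∑ i, A i j = lam j * (Fintype.card V).choose (h j)) (T : Finset V) :
    ∀ N : ℕ, T.card + N = Fintype.card V → ∃ f : Fin k → Fin m → Finset V → ℤ,
      (∀ i j S, 0 ≤ f i j S) ∧
      (∀ j, ∀ S ⊆ T, ∑ i, f i j S = lam j * extensionCount N (h j) S.card) ∧
      (∀ i, (N : ℤ) * Q i ≤ ∑ j, ∑ S ∈ T.powerset, f i j S * ((h j : ℤ) - S.card)) ∧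
      (∀ i, ∑ j, ∑ S ∈ T.powerset, f i j S * ((h j : ℤ) - S.card) ≤ (N : ℤ) * R i) ∧
      ∀ v ∈ T, ∀ i, Q i ≤ ∑ j, ∑ S ∈ T.powerset, f i j S * (if v ∈ S then 1 else 0) ∧
        ∑ j, ∑ S ∈ T.powerset, f i j S * (if v ∈ S then 1 else 0) ≤ R i := by
  induction T using Finset.induction_on with
  | empty =>
    intro N hN
    rw [Finset.card_empty, zero_add] at hN
    subst hN
    refine ⟨fun i j _ => A i j, fun i j S => by positivity, ?_, ?_, ?_, by simp⟩
    · intro j S hS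
      rw [Finset.subset_empty.1 hS]
      simpa [extensionCount] using congrArg (Nat.cast : ℕ → ℤ) (hA j)
    · simpa using hQ
    · simpa using hR
  | insert v T hv ih =>
    intro N hN
    rw [Finset.card_insert_of_notMem hv] at hN
    obtain ⟨f, hf0, hfc, hfQ, hfR, hfd⟩ := ih (N + 1) (by omega)
    have hNpos : (0 : ℝ) < N + 1 := by positivity
    have hrange : ∀ i j, ∀ S ⊆ T, f i j S = 0 ∨ S.card ≤ h j ∧ h j ≤ S.card + (N + 1) := by
      intro i j S hS
      by_cases hc : extensionCount (N + 1) (h j) S.card = 0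
      · left
        have h1 := hfc j S hS
        rw [hc, mul_zero] at h1
        exact (Finset.sum_eq_zero_iff_of_nonneg fun i _ => hf0 i j S).1 h1 i (Finset.mem_univ i)
      · exact Or.inr (extensionCount_ne_zero hc)
    -- The hinges of class i still to be attached to the N + 1 unprocessed vertices.
    let D : Fin k → ℤ := fun i => ∑ j, ∑ S ∈ T.powerset, f i j S * ((h j : ℤ) - S.card)
    have hsum : ∀ i, ∑ p : Fin m × Finset V, (if p.2 ∈ T.powerset then
        (f i p.1 p.2 * ((h p.1 : ℤ) - p.2.card) : ℝ) / (N + 1) else 0) = D i / (N + 1) := by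
      intro i
      rw [Fintype.sum_prod_type]
      simp only [Finset.sum_ite_mem, Finset.univ_inter, ← Finset.sum_div, D]
      push_cast
      rfl
    have hQD : ∀ i, ((N : ℝ) + 1) * Q i ≤ D i := fun i => by
      have h1 : ((N + 1 : ℕ) : ℤ) * Q i ≤ D i := hfQ i
      exact_mod_cast h1
    have hRD : ∀ i, (D i : ℝ) ≤ (N + 1) * R i := fun i => by
      have h1 : D i ≤ ((N + 1 : ℕ) : ℤ) * R i := hfR i
      exact_mod_cast h1
    -- `y i (j, S)` counts the edges that will contain `v`. Its row sum d is the degree of `v` in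
    -- class i, so both Q ≤ d ≤ R and N Q ≤ D - d ≤ N R are required.
    obtain ⟨y, hy0, hyu, hya, hyb, hyc⟩ := exists_int_rounding (ι := Fin k)
      (κ := Fin m × Finset V) (fun i p => if p.2 ∈ T.powerset then f i p.1 p.2 else 0)
      (fun i => max (Q i) (D i - N * R i)) (fun i => min (R i) (D i - N * Q i))
      (fun p => if p.2 ∈ T.powerset then lam p.1 * extensionCount N (h p.1) (p.2.card + 1) else 0)
      (fun i p => if p.2 ∈ T.powerset then
        (f i p.1 p.2 * ((h p.1 : ℤ) - p.2.card) : ℝ) / (N + 1) else 0)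
      (by
        rintro i ⟨j, S⟩
        dsimp only
        split_ifs with hS
        · rcases hrange i j S (Finset.mem_powerset.1 hS) with h0 | ⟨h1, -⟩
          · simp [h0]
          · have h2 : (0 : ℝ) ≤ f i j S := by exact_mod_cast hf0 i j S
            have h3 : (S.card : ℝ) ≤ h j := by exact_mod_cast h1
            have h4 : (0 : ℝ) ≤ ((h j : ℤ) : ℝ) - S.card := by
              push_cast
              linarith
            positivity
        · exact le_rfl)
      (by
        rintro i ⟨j, S⟩
        dsimp only
        split_ifs with hS
        · rcases hrange i j S (Finset.mem_powerset.1 hS) with h0 | ⟨-, h1⟩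
          · simp [h0]
          · have h2 : (0 : ℝ) ≤ f i j S := by exact_mod_cast hf0 i j S
            have h3 : (h j : ℝ) ≤ S.card + (N + 1) := by exact_mod_cast h1
            rw [div_le_iff₀ hNpos]
            refine mul_le_mul_of_nonneg_left ?_ h2
            push_cast
            linarith
        · simp)
      (by
        intro i
        rw [hsum, Int.cast_max, max_le_iff, le_div_iff₀ hNpos, le_div_iff₀ hNpos]
        have h1 := hQD i
        -- Cleared of the denominator, D - N R ≤ D/(N + 1) is N D ≤ N (N + 1) R.
        have h2 := mul_le_mul_of_nonneg_left (hRD i) (Nat.cast_nonneg (α := ℝ) N)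
        push_cast
        constructor <;> nlinarith)
      (by
        intro i
        rw [hsum, Int.cast_min, le_min_iff, div_le_iff₀ hNpos, div_le_iff₀ hNpos]
        have h1 := hRD i
        have h2 := mul_le_mul_of_nonneg_left (hQD i) (Nat.cast_nonneg (α := ℝ) N)
        push_cast
        constructor <;> nlinarith)
      (by
        rintro ⟨j, S⟩
        dsimp only
        split_ifs with hS
        · rw [← Finset.sum_div, ← Finset.sum_mul, div_eq_iff hNpos.ne']
          have h1 := hfc j S (Finset.mem_powerset.1 hS)
          have h2 := extensionCount_succ_mul N (h j) S.card
          have h3 : (∑ i, f i j S) * ((h j : ℤ) - S.card) =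
              lam j * extensionCount N (h j) (S.card + 1) * (N + 1) := by
            rw [h1, mul_assoc, h2]
            ring
          exact_mod_cast h3
        · simp)
    have hyD : ∀ i, ∑ p, y i p = ∑ j, ∑ S ∈ T.powerset, y i (j, S) := by
      intro i
      rw [Fintype.sum_prod_type]
      refine Finset.sum_congr rfl fun j _ => (Finset.sum_subset (Finset.subset_univ _) ?_).symm
      intro S _ hS
      have h1 := hyu i (j, S)
      rw [if_neg hS] at h1
      exact le_antisymm h1 (hy0 _ _)
    -- Of the edges with trace S on `T`, `y` gain `v` and the rest keep trace S.
    let f' : Fin k → Fin m → Finset V → ℤ := fun i j S =>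
      if v ∈ S then y i (j, S.erase v) else f i j S - y i (j, S)
    have hf'sum : ∀ i j (g : Finset V → ℤ), ∑ S ∈ (insert v T).powerset, f' i j S * g S =
        ∑ S ∈ T.powerset, ((f i j S - y i (j, S)) * g S + y i (j, S) * g (insert v S)) := by
      intro i j g
      rw [Finset.sum_powerset_insert hv, ← Finset.sum_add_distrib]
      refine Finset.sum_congr rfl fun S hS => ?_
      have hvS : v ∉ S := fun h => hv (Finset.mem_powerset.1 hS h)
      simp only [f', if_neg hvS, Finset.mem_insert_self, if_true, Finset.erase_insert hvS]
    have hf'D : ∀ i, ∑ j, ∑ S ∈ (insert v T).powerset, f' i j S * ((h j : ℤ) - S.card) =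
        D i - ∑ p, y i p := by
      intro i
      rw [hyD, ← Finset.sum_sub_distrib]
      refine Finset.sum_congr rfl fun j _ => ?_
      rw [hf'sum i j fun S => (h j : ℤ) - S.card, ← Finset.sum_sub_distrib]
      refine Finset.sum_congr rfl fun S hS => ?_
      have hvS : v ∉ S := fun h => hv (Finset.mem_powerset.1 hS h)
      rw [Finset.card_insert_of_notMem hvS]
      push_cast
      ring
    have hle : ∀ i j S, y i (j, S) ≤ f i j S := by
      intro i j S
      have h1 := hyu i (j, S)
      dsimp only at h1
      split_ifs at h1
      · exact h1
      · exact h1.trans (hf0 _ _ _)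
    refine ⟨f', ?_, ?_, ?_, ?_, ?_⟩
    · intro i j S
      dsimp only [f']
      split_ifs
      · exact hy0 _ _
      · exact sub_nonneg.2 (hle i j S)
    · intro j S hS
      by_cases hvS : v ∈ S
      · simp only [f', if_pos hvS]
        have h1 : S.erase v ∈ T.powerset := Finset.mem_powerset.2 (Finset.subset_insert_iff.1 hS)
        rw [hyc, if_pos h1, Finset.card_erase_add_one hvS]
      · simp only [f', if_neg hvS]
        have h1 : S ⊆ T := (Finset.subset_insert_iff_of_notMem hvS).1 hS
        rw [Finset.sum_sub_distrib, hfc j S h1, hyc, if_pos (Finset.mem_powerset.2 h1),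
          extensionCount_succ]
        ring
    · intro i
      rw [hf'D]
      have := (hyb i).trans (min_le_right _ _)
      linarith
    · intro i
      rw [hf'D]
      have := (le_max_right _ _).trans (hya i)
      linarith
    · intro w hw i
      have key : ∑ j, ∑ S ∈ (insert v T).powerset, f' i j S * (if w ∈ S then 1 else 0) =
          if w = v then ∑ p, y i p
          else ∑ j, ∑ S ∈ T.powerset, f i j S * (if w ∈ S then 1 else 0) := by
        rw [hyD]
        split_ifs with hwv
        · subst hwv
          refine Finset.sum_congr rfl fun j _ => ?_
          rw [hf'sum i j fun S => if w ∈ S then 1 else 0]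
          refine Finset.sum_congr rfl fun S hS => ?_
          have hvS : w ∉ S := fun h => hv (Finset.mem_powerset.1 hS h)
          simp [hvS]
        · refine Finset.sum_congr rfl fun j _ => ?_
          rw [hf'sum i j fun S => if w ∈ S then 1 else 0]
          refine Finset.sum_congr rfl fun S hS => ?_
          simp only [Finset.mem_insert, hwv, false_or]
          ring
      rw [key]
      split_ifs with hwv
      · exact ⟨(le_max_left _ _).trans (hya i), (hyb i).trans (min_le_left _ _)⟩
      · exact hfd w ((Finset.mem_insert.1 hw).resolve_left hwv) i

/-- The final counts: `g i U` edges of the `i`-th class join exactly the vertices of `U`. -/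
theorem exists_class_counts {V : Type*} [Fintype V] [DecidableEq V] {k m : ℕ} (lam h : Fin m → ℕ)
    (Q R : Fin k → ℤ) (A : Fin k → Fin m → ℕ)
    (hQ : ∀ i, (Fintype.card V : ℤ) * Q i ≤ ∑ j, (A i j : ℤ) * h j)
    (hR : ∀ i, ∑ j, (A i j : ℤ) * h j ≤ (Fintype.card V : ℤ) * R i)
    (hA : ∀ j, ∑ i, A i j = lam j * (Fintype.card V).choose (h j)) :
    ∃ g : Fin k → Finset V → ℕ,
      (∀ U, ∑ i, g i U = ∑ j, if U.card = h j then lam j else 0) ∧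
      ∀ v i, Q i ≤ (∑ U with v ∈ U, g i U : ℕ) ∧ ((∑ U with v ∈ U, g i U : ℕ) : ℤ) ≤ R i := by
  obtain ⟨f, hf0, hfc, -, -, hfd⟩ := exists_trace_counts lam h Q R A hQ hR hA Finset.univ 0
    (by simp)
  lift f to Fin k → Fin m → Finset V → ℕ using hf0
  refine ⟨fun i U => ∑ j, f i j U, fun U => ?_, fun v i => ?_⟩
  · rw [Finset.sum_comm]
    refine Finset.sum_congr rfl fun j _ => ?_
    have h1 := hfc j U (Finset.subset_univ U)
    -- With no vertex left, a trace is the whole vertex set of its edge.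
    have h2 : extensionCount 0 (h j) U.card = if U.card = h j then 1 else 0 := by
      unfold extensionCount
      rcases lt_trichotomy U.card (h j) with hs | hs | hs
      · rw [if_pos hs.le, if_neg hs.ne, Nat.choose_eq_zero_of_lt (by omega), Nat.cast_zero]
      · simp [hs]
      · rw [if_neg (by omega), if_neg hs.ne']
    rw [h2, mul_ite, mul_one, mul_zero] at h1
    dsimp only at h1
    exact_mod_cast h1
  · have h1 := hfd v (Finset.mem_univ v) i
    have h2 : ∑ j, ∑ S ∈ (Finset.univ : Finset V).powerset,
        (f i j S : ℤ) * (if v ∈ S then 1 else 0) = (∑ U with v ∈ U, ∑ j, f i j U : ℕ) := by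
      rw [Finset.powerset_univ, Finset.sum_comm, Finset.sum_filter]
      push_cast
      refine Finset.sum_congr rfl fun S _ => ?_
      split_ifs <;> simp
    rwa [h2] at h1

end Counts

/-! ### Passage between counts and factorizations -/

/-- A finite set can be coloured with prescribed sizes of the colour classes. -/
theorem exists_coloring_of_sum_eq {α : Type*} [Fintype α] {k : ℕ} (g : Fin k → ℕ)
    (hg : ∑ i, g i = Fintype.card α) :
    ∃ c : α → Fin k, ∀ i, {a | c a = i}.ncard = g i := by
  have e : α ≃ Σ i, Fin (g i) := Fintype.equivOfCardEq (by simp [hg])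
  refine ⟨fun a => (e a).1, fun i => ?_⟩
  have h1 : {a | (e a).1 = i} = Set.range fun t : Fin (g i) => e.symm ⟨i, t⟩ := by
    ext a
    constructor
    · rintro rfl
      exact ⟨(e a).2, by simp⟩
    · rintro ⟨t, rfl⟩
      simp
  rw [h1, Set.ncard_range_of_injective]
  · simp
  · intro s t hst
    simpa using hst

namespace HingeHypergraph

variable {V : Type*} {E : Type*} {I : Type*}

/-- The degree of `v` in a spanning sub-hypergraph of a hypergraph in which every edge `e` joins
exactly the vertices of `U e`. -/
theorem degree_spanningSub [DecidableEq V] [Finite I] (G : HingeHypergraph V E I)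
    (U : E → Finset V) (hU : ∀ e, e ∈ G.edgesJoining (U e).1) (F : Set E) (v : V) :
    (G.spanningSub F).degree v = {e | e ∈ F ∧ v ∈ U e}.ncard := by
  have hcount : ∀ e, (G.hingesAt v e).ncard = if v ∈ U e then 1 else 0 := fun e => by
    rw [hU e v, Multiset.count_eq_of_nodup (U e).2]
    rfl
  -- An edge has at most one hinge at `v`, so hinges at `v` correspond to edges containing `v`.
  refine Set.ncard_congr (fun x _ => G.edge x.1) ?_ ?_ ?_
  · rintro ⟨x, hx⟩ hv
    refine ⟨hx, ?_⟩
    by_contra hmem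
    have h1 := hcount (G.edge x)
    rw [if_neg hmem, Set.ncard_eq_zero] at h1
    exact (Set.mem_empty_iff_false x).1 (h1 ▸ (⟨hv, rfl⟩ : x ∈ G.hingesAt v (G.edge x)))
  · rintro ⟨x, hx⟩ ⟨y, hy⟩ hxv hyv hxy
    have h1 : (G.hingesAt v (G.edge x)).ncard ≤ 1 := by
      rw [hcount]
      split_ifs <;> simp
    exact Subtype.ext ((Set.ncard_le_one_iff).1 h1 ⟨hxv, rfl⟩ ⟨hyv, Eq.symm hxy⟩)
  · rintro e ⟨heF, hev⟩
    have h1 := hcount e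
    rw [if_pos hev] at h1
    obtain ⟨x, hx⟩ := Set.ncard_eq_one.1 h1
    have hx' : x ∈ G.hingesAt v e := hx ▸ Set.mem_singleton x
    obtain ⟨hxv, rfl⟩ := hx'
    exact ⟨⟨x, heF⟩, hxv, rfl⟩

/-- The edges that join exactly the vertices of `W` are those whose vertex set is `W`. -/
theorem edgesJoining_eq [DecidableEq V] (G : HingeHypergraph V E I) (U : E → Finset V)
    (hU : ∀ e, e ∈ G.edgesJoining (U e).1) (W : Finset V) :
    G.edgesJoining W.1 = {e | U e = W} := by
  ext e
  constructor
  · intro he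
    refine Finset.val_injective (Multiset.ext.2 fun v => ?_)
    rw [← hU e v, ← he v]
  · rintro rfl
    exact hU e

/-- The numbers of edges of a `Λ K_n^H` with given vertex sets. -/
theorem IsLambdaK.card_edges [DecidableEq V] {G : HingeHypergraph V E I} {m : ℕ} {lam h : Fin m → ℕ}
    (hinj : Function.Injective h) (hG : G.IsLambdaK lam h) (U : E → Finset V)
    (hU : ∀ e, e ∈ G.edgesJoining (U e).1) (hJ : ∀ e, ∃ j, (U e).card = h j) (W : Finset V) :
    {e | U e = W}.ncard = ∑ j, if W.card = h j then lam j else 0 := by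
  by_cases hW : ∃ j, W.card = h j
  · obtain ⟨j, hj⟩ := hW
    rw [← G.edgesJoining_eq U hU, Finset.sum_eq_single j, if_pos hj]
    · exact hG.multiplicity_eq j W hj
    · intro b _ hb
      exact if_neg fun hbj => hb (hinj (hbj.symm.trans hj))
    · simp
  · push Not at hW
    rw [Finset.sum_eq_zero fun j _ => if_neg (hW j)]
    have h1 : {e | U e = W} = ∅ := by
      refine Set.eq_empty_iff_forall_notMem.2 ?_
      rintro e rfl
      obtain ⟨j, hj⟩ := hJ e
      exact hW j hj
    rw [h1, Set.ncard_empty]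

/-- A hypergraph all of whose edges join sets of vertices is factorizable if there is a feasible
prescription of the number of edges of each class with each given vertex set. -/
theorem factorizable_of_counts [Fintype V] [DecidableEq V] [Finite E] [Finite I]
    (G : HingeHypergraph V E I) (U : E → Finset V) (hU : ∀ e, e ∈ G.edgesJoining (U e).1) {k : ℕ}
    (Q R : Fin k → ℤ) (g : Fin k → Finset V → ℕ) (hg : ∀ W, ∑ i, g i W = {e | U e = W}.ncard)
    (hd : ∀ v i, Q i ≤ (∑ W with v ∈ W, g i W : ℕ) ∧ ((∑ W with v ∈ W, g i W : ℕ) : ℤ) ≤ R i) :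
    G.Factorizable Q R := by
  classical
  have := Fintype.ofFinite E
  -- Degrees depend only on vertex sets, so each bundle of parallel edges may be coloured
  -- independently and arbitrarily.
  have hcol : ∀ W, ∃ c : {e // U e = W} → Fin k, ∀ i, {a | c a = i}.ncard = g i W := fun W =>
    exists_coloring_of_sum_eq (fun i => g i W) (by
      rw [hg, ← Nat.card_coe_set_eq, ← Nat.card_eq_fintype_card]
      rfl)
  choose c hc using hcol
  let col : E → Fin k := fun e => c (U e) ⟨e, rfl⟩
  have hcard : ∀ i W, (Finset.univ.filter fun e => col e = i ∧ U e = W).card = g i W := by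
    intro i W
    rw [← hc W i, ← Set.ncard_coe_finset]
    refine (Set.ncard_congr (fun a _ => a.1) ?_ ?_ ?_).symm
    · rintro ⟨e, rfl⟩ h
      simpa [col] using h
    · intro a b _ _ hab
      exact Subtype.ext hab
    · intro e he
      obtain ⟨h1, rfl⟩ : col e = i ∧ U e = W := by simpa using he
      exact ⟨⟨e, rfl⟩, h1, rfl⟩
  refine ⟨fun i => {e | col e = i}, ?_, ?_, ?_⟩
  · intro i j hij
    refine Set.disjoint_left.2 fun e hi hj => hij ?_
    exact (Eq.symm hi).trans hj
  · exact Set.eq_univ_of_forall fun e => Set.mem_iUnion.2 ⟨col e, rfl⟩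
  · intro i v
    have h1 : (G.spanningSub {e | col e = i}).degree v = ∑ W with v ∈ W, g i W := by
      rw [G.degree_spanningSub U hU]
      have h2 : {e | e ∈ {e | col e = i} ∧ v ∈ U e} =
          ((Finset.univ.filter fun e => col e = i ∧ v ∈ U e : Finset E) : Set E) := by
        ext e
        simp
      rw [h2, Set.ncard_coe_finset, Finset.card_eq_sum_card_fiberwise (f := U)
        (t := Finset.univ.filter fun W => v ∈ W)]
      · refine Finset.sum_congr rfl fun W hW => ?_
        rw [← hcard, Finset.filter_filter]
        congr 1
        ext e
        simp only [Finset.mem_filter, Finset.mem_univ, true_and] at hW ⊢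
        constructor
        · rintro ⟨⟨h3, -⟩, h4⟩
          exact ⟨h3, h4⟩
        · rintro ⟨h3, rfl⟩
          exact ⟨⟨h3, hW⟩, rfl⟩
      · intro e he
        simp only [Finset.coe_filter, Finset.mem_univ, true_and, Set.mem_ofPred_eq] at he ⊢
        exact he.2
    rw [h1]
    exact hd v i

/-- The edges of size `h j` in the `i`-th class of a factorization give a feasible matrix. -/
theorem Factorizable.exists_matrix [Fintype V] [DecidableEq V] [Finite E] [Finite I]
    {G : HingeHypergraph V E I} {m : ℕ} {lam h : Fin m → ℕ} (hinj : Function.Injective h)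
    (hG : G.IsLambdaK lam h) (U : E → Finset V) (hU : ∀ e, e ∈ G.edgesJoining (U e).1)
    (hJ : ∀ e, ∃ j, (U e).card = h j) {k : ℕ} {Q R : Fin k → ℤ} (hF : G.Factorizable Q R) :
    ∃ A : Matrix (Fin k) (Fin m) ℕ,
      (∀ i, (Fintype.card V : ℤ) * Q i ≤ (((A *ᵥ h) i : ℕ) : ℤ) ∧
        (((A *ᵥ h) i : ℕ) : ℤ) ≤ (Fintype.card V : ℤ) * R i) ∧
      ∀ j, ∑ i, A i j = lam j * (Fintype.card V).choose (h j) := by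
  classical
  have := Fintype.ofFinite E
  obtain ⟨F, hdisj, hcov, hfac⟩ := hF
  choose J hJ using hJ
  have hcol : ∀ e, ∃ i, e ∈ F i := fun e =>
    Set.mem_iUnion.1 (hcov ▸ Set.mem_univ e : e ∈ ⋃ i, F i)
  choose col hcol using hcol
  have hmem : ∀ e i, e ∈ F i ↔ col e = i := by
    intro e i
    constructor
    · intro he
      by_contra hne
      exact Set.disjoint_left.1 (hdisj hne) (hcol e) he
    · rintro rfl
      exact hcol e
  refine ⟨fun i j => (Finset.univ.filter fun e => col e = i ∧ J e = j).card, fun i => ?_,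
    fun j => ?_⟩
  · have h1 : ∀ v, (G.spanningSub (F i)).degree v =
        ∑ e with col e = i, if v ∈ U e then 1 else 0 := by
      intro v
      rw [G.degree_spanningSub U hU, ← Finset.card_filter, ← Set.ncard_coe_finset]
      congr 1
      ext e
      simp [hmem]
    -- Both sides count the hinges of class i, by edges and by vertices.
    have h2 : ((fun i j => (Finset.univ.filter fun e => col e = i ∧ J e = j).card :
        Matrix (Fin k) (Fin m) ℕ) *ᵥ h) i = ∑ v, (G.spanningSub (F i)).degree v := by
      simp only [h1, Matrix.mulVec, dotProduct]
      rw [Finset.sum_comm, ← Finset.sum_fiberwise _ J]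
      refine Finset.sum_congr rfl fun j _ => ?_
      rw [Finset.filter_filter, Finset.sum_congr rfl (g := fun _ => h j)]
      · rw [Finset.sum_const, smul_eq_mul]
      · intro e he
        obtain ⟨-, rfl⟩ : col e = i ∧ J e = j := by simpa using he
        rw [← hJ]
        simp
    rw [h2, ← Finset.card_univ]
    push_cast
    rw [← nsmul_eq_mul, ← nsmul_eq_mul]
    exact ⟨Finset.card_nsmul_le_sum _ _ _ fun v _ => (hfac i v).1,
      Finset.sum_le_card_nsmul _ _ _ fun v _ => (hfac i v).2⟩
  · have h1 : ∀ i, (Finset.univ.filter fun e => col e = i ∧ J e = j).card =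
        ((Finset.univ.filter fun e => J e = j).filter fun e => col e = i).card := by
      intro i
      rw [Finset.filter_filter]
      simp only [and_comm]
    simp only [h1]
    rw [← Finset.card_eq_sum_card_fiberwise fun _ _ => Finset.mem_coe.2 (Finset.mem_univ _),
      Finset.card_eq_sum_card_fiberwise (f := U) (t := Finset.univ.powersetCard (h j))]
    · rw [Finset.sum_congr rfl (g := fun _ => lam j)]
      · rw [Finset.sum_const, smul_eq_mul, Finset.card_powersetCard, Finset.card_univ, mul_comm]
      · intro W hW
        have hW' : W.card = h j := (Finset.mem_powersetCard.1 hW).2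
        rw [← hG.multiplicity_eq j W hW', multiplicity, G.edgesJoining_eq U hU,
          ← Set.ncard_coe_finset]
        congr 1
        ext e
        simp only [Finset.filter_filter, Finset.coe_filter, Finset.mem_univ, true_and,
          Set.mem_ofPred_eq, and_iff_right_iff_imp]
        rintro rfl
        -- Distinct sizes ensure that every edge on `W` has index j.
        exact hinj ((hJ e).symm.trans hW')
    · intro e he
      obtain rfl : J e = j := by simpa using he
      simpa using hJ e

end HingeHypergraph

/-! ### The characterization -/

theorem theorem6p3 {V : Type*} {E : Type*} {I : Type*} [Fintype V] [DecidableEq V] [Finite E]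
    [Finite I] (G : HingeHypergraph V E I) (n m k : ℕ) (hn : 1 ≤ n) (hV : Fintype.card V = n)
    (lam h : Fin m → ℕ) (hlam : ∀ j, 1 ≤ lam j) (hh : ∀ j, h j ∈ Finset.Icc 1 n)
    (hinj : Function.Injective h) (hG : G.IsLambdaK lam h) (Q R : Fin k → ℤ) :
    G.Factorizable Q R ↔
      (∑ i, Q i ≤ ((∑ j, lam j * (n - 1).choose (h j - 1) : ℕ) : ℤ) ∧
        ((∑ j, lam j * (n - 1).choose (h j - 1) : ℕ) : ℤ) ≤ ∑ i, R i) ∧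
      ∃ A : Matrix (Fin k) (Fin m) ℕ,
        (∀ i, (n : ℤ) * Q i ≤ (((A *ᵥ h) i : ℕ) : ℤ) ∧ (((A *ᵥ h) i : ℕ) : ℤ) ≤ (n : ℤ) * R i) ∧
        ∀ j, ∑ i, A i j = lam j * n.choose (h j) := by
  subst hV
  choose J U hJ hU using hG.edge_joins
  have hJ' : ∀ e, ∃ j, (U e).card = h j := fun e => ⟨J e, hJ e⟩
  constructor
  · intro hF
    obtain ⟨A, hA, hsum⟩ := hF.exists_matrix hinj hG U hU hJ'
    -- All hinges, counted through the identity h·C(n,h) = n·C(n-1,h-1); dividing by n ≥ 1 then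
    -- gives the two sum inequalities.
    have htotal : ∑ i, (A *ᵥ h) i =
        Fintype.card V * ∑ j, lam j * (Fintype.card V - 1).choose (h j - 1) := by
      simp only [Matrix.mulVec, dotProduct]
      rw [Finset.sum_comm, Finset.mul_sum]
      refine Finset.sum_congr rfl fun j _ => ?_
      rw [← Finset.sum_mul, hsum]
      obtain ⟨N, hN⟩ := Nat.exists_eq_add_of_le' hn
      obtain ⟨t, ht⟩ := Nat.exists_eq_add_of_le' (Finset.mem_Icc.1 (hh j)).1
      rw [hN, ht, Nat.add_sub_cancel, Nat.add_sub_cancel, mul_assoc,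
        ← Nat.add_one_mul_choose_eq, mul_left_comm]
    have hn' : (0 : ℤ) < Fintype.card V := by exact_mod_cast hn
    refine ⟨⟨?_, ?_⟩, A, hA, hsum⟩
    · refine le_of_mul_le_mul_left ?_ hn'
      rw [Finset.mul_sum, ← Nat.cast_mul, ← htotal, Nat.cast_sum]
      exact Finset.sum_le_sum fun i _ => (hA i).1
    · refine le_of_mul_le_mul_left ?_ hn'
      rw [Finset.mul_sum, ← Nat.cast_mul, ← htotal, Nat.cast_sum]
      exact Finset.sum_le_sum fun i _ => (hA i).2
  · rintro ⟨-, A, hA, hsum⟩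
    obtain ⟨g, hg, hd⟩ := exists_class_counts lam h Q R A
      (fun i => by simpa [Matrix.mulVec, dotProduct] using (hA i).1)
      (fun i => by simpa [Matrix.mulVec, dotProduct] using (hA i).2) hsum
    exact G.factorizable_of_counts U hU Q R g
      (fun W => (hg W).trans (hG.card_edges hinj U hU hJ' W).symm) hd
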